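/- Let $\mu$ be a positive Borel measure on $\mathbb{R}$ with finite moments of all orders, and let $\mathbf{P}=(p_0\ p_1\ \cdots)$ be polynomials with $\deg p_n=n$ that are orthonormal in $L^2(\mathbb{R},\mathrm{d}\mu)$ (so the support of $\mu$ is infinite). For a measurable $g:\mathbb{R}\to\mathbb{R}$ with finite $\mu$-moments $\int x^n g\,\mathrm{d}\mu$, $n\ge0$, let $g(X_P)$ be the function $g$ of the Jacobi matrix $X_P$ of $\mathbf P$, that is, the infinite matrix with entries $g(X_P)_{i,j}=\int_{\mathbb{R}} p_i(x)\,g(x)\,p_j(x)\,\mathrm{d}\mu(x)$. Let $f$ be positive and differentiable on $(0,\infty)$ with $f'$ completely monotonic there, i.e. $f'$ is smooth and $(-1)^k (f')^{(k)}(x)\ge0$ for all $x>0$ and $k\ge0$. Let $s:\mathbb{R}\to\mathbb{R}$ be measurable (for instance smooth), positive $\mu$-almost everywhere, with finite $\mu$-moments, and suppose that polynomials are dense in $L^2(\mathbb{R},(1+s)\,\mathrm{d}\mu)$ (hence in $L^2(\mathbb{R},\mathrm{d}\mu)$). Put $r=f\circ s$. Let $\mathbf{Q}=(q_0\ q_1\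 \cdots)$, $\deg q_n=n$, be orthonormal polynomials in $L^2(\mathbb{R},r\,\mathrm{d}\mu)$, normalized so that the leading coefficients of $q_n$ and $p_n$ have the same sign, and let $R$ be the upper triangular infinite connection matrix with $\mathbf{P}=\mathbf{Q}R$, i.e. $p_n=\sum_{k=0}^n R_{k,n}q_k$. A real $n\times n$ matrix $A$ is called an M-matrix if $A_{i,i}>0$ for all $i$, $A_{i,j}\le0$ for $i\ne j$, and all (complex) eigenvalues of $A$ have positive real part; a symmetric M-matrix (equivalently, a symmetric positive definite matrix with nonpositive off-diagonal entries) is called a Stieltjes matrix. The $n\times n$ principal finite section of an infinite matrix is its leading $n\times n$ block. If all principal finite sections of $s(X_P)$ are Stieltjes matrices, then for every $n$ the $n\times n$ principal finite section of $r(X_P)$ is a Stieltjes matrix if and only if the $n\times n$ principal finite section of $R$ is an M-matrix. -/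

import Mathlib

open MeasureTheory Polynomial
open scoped ENNReal ContDiff

namespace OrthoConn

/-- `r` has finite moments of every order with respect to `μ`. -/
def HasFiniteMoments (μ : Measure ℝ) (r : ℝ → ℝ) : Prop :=
  ∀ n : ℕ, Integrable (fun x => x ^ n * r x) μ

/-- A degree-graded family of polynomials that is orthonormal in `L²(ν)`. -/
structure IsOrthonormalPolys (ν : Measure ℝ) (p : ℕ → ℝ[X]) : Prop where
  degree_eq : ∀ n, (p n).degree = n
  orthonormal : ∀ m n, ∫ x, (p m).eval x * (p n).eval x ∂ν = if m = n then 1 else 0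

/-- Polynomials are dense in `L²(ν)`. -/
def PolynomialsDense (ν : Measure ℝ) : Prop :=
  ∀ g : ℝ → ℝ, MemLp g 2 ν → ∀ ε : ℝ≥0∞, 0 < ε →
    ∃ h : ℝ[X], eLpNorm (fun x => g x - h.eval x) 2 ν < ε

/-- The measure `r dμ`, for `r` nonnegative `μ`-almost everywhere. -/
noncomputable def modifiedMeasure (μ : Measure ℝ) (r : ℝ → ℝ) : Measure ℝ :=
  μ.withDensity fun x => ENNReal.ofReal (r x)

/-- The infinite matrix `r(X_P) = ∫ r dμ_P`, where `dμ_P = Pᵀ P dμ` is the matrix-valued spectral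
measure of the Jacobi matrix `X_P` of the orthonormal polynomials `P = (p 0, p 1, …)` of `μ`.
For `r x = x` it is `X_P` itself. -/
noncomputable def functionOfJacobi (μ : Measure ℝ) (p : ℕ → ℝ[X]) (r : ℝ → ℝ) : Matrix ℕ ℕ ℝ :=
  Matrix.of fun i j => ∫ x, (p i).eval x * r x * (p j).eval x ∂μ

/-- `R` is the connection matrix in `P = Q R`: it is upper triangular and
`p n = ∑ k ≤ n, R k n • q k`. -/
structure IsConnectionMatrix (p q : ℕ → ℝ[X]) (R : Matrix ℕ ℕ ℝ) : Prop where
  upper : ∀ k n, n < k → R k n = 0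
  expansion : ∀ n, p n = ∑ k ∈ Finset.range (n + 1), R k n • q k

/-- The `n × n` principal finite section of an infinite matrix. -/
def finiteSection (A : Matrix ℕ ℕ ℝ) (n : ℕ) : Matrix (Fin n) (Fin n) ℝ :=
  A.submatrix Fin.val Fin.val

/-- A (nonsingular) M-matrix: positive diagonal, nonpositive off-diagonal entries, and positive
definite in the sense that is meant for matrices that need not be symmetric: every complex
eigenvalue has positive real part. -/
structure IsMMatrix {n : ℕ} (A : Matrix (Fin n) (Fin n) ℝ) : Prop where
  diag_pos : ∀ i, 0 < A i i
  offDiag_nonpos : ∀ i j, i ≠ j → A i j ≤ 0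
  spectrum_pos : ∀ z ∈ spectrum ℂ (A.map (algebraMap ℝ ℂ)), 0 < z.re

/-- A Stieltjes matrix is a symmetric M-matrix. -/
def IsStieltjes {n : ℕ} (A : Matrix (Fin n) (Fin n) ℝ) : Prop :=
  A.IsSymm ∧ IsMMatrix A

/-- `g` is completely monotonic on `(0, ∞)`. -/
def IsCompletelyMonotonic (g : ℝ → ℝ) : Prop :=
  ContDiffOn ℝ ∞ g (Set.Ioi 0) ∧
    ∀ k : ℕ, ∀ x : ℝ, 0 < x → 0 ≤ (-1) ^ k * iteratedDeriv k g x

/-- Consistency of the definitions: Stieltjes matrices are the positive definite (symmetric)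
matrices with nonpositive off-diagonal entries. -/
theorem isStieltjes_iff {n : ℕ} (A : Matrix (Fin n) (Fin n) ℝ) :
    IsStieltjes A ↔ A.PosDef ∧ ∀ i j, i ≠ j → A i j ≤ 0 := by
  have key : ∀ hA : A.IsHermitian, ∀ z : ℂ,
      z ∈ spectrum ℂ (A.map (algebraMap ℝ ℂ)) ↔ ∃ i, z = (hA.eigenvalues i : ℂ) := by
    intro hA z
    rw [Matrix.mem_spectrum_iff_isRoot_charpoly, Matrix.charpoly_map, hA.charpoly_eq,
      Polynomial.map_prod, Polynomial.IsRoot, Polynomial.eval_prod, Finset.prod_eq_zero_iff]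
    simp [sub_eq_zero]
  constructor
  · rintro ⟨hs, hM⟩
    have hA : A.IsHermitian := by
      rw [Matrix.IsHermitian, Matrix.conjTranspose_eq_transpose_of_trivial]; exact hs
    refine ⟨hA.posDef_iff_eigenvalues_pos.2 fun i => ?_, hM.offDiag_nonpos⟩
    simpa using hM.spectrum_pos _ ((key hA _).2 ⟨i, rfl⟩)
  · rintro ⟨hP, hoff⟩
    have hA := hP.isHermitian
    refine ⟨?_, fun i => hP.diag_pos, hoff, fun z hz => ?_⟩
    · rw [Matrix.IsHermitian, Matrix.conjTranspose_eq_transpose_of_trivial] at hA; exact hA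
    · obtain ⟨i, rfl⟩ := (key hA z).1 hz
      simpa using hA.posDef_iff_eigenvalues_pos.1 hP i

end OrthoConn

/-!
The matrices `r(X_P)` and `R` are tied by the Cholesky factorization `r(X_P) = Rᵀ R`
(`functionOfJacobi_eq_sum`), in which `R` is upper triangular with positive diagonal. Every finite
section of `R` is therefore invertible, every finite section of `r(X_P)` is positive definite, and
nonpositive off-diagonal entries pass from `Rᵀ R` to `R` by induction on the row
(`upper_nonpos_of_gram_nonpos`). Thus a Stieltjes section of `r(X_P)` forces `R` to be an M-matrix.
For the equivalence it remains to see that the hypothesis on `s(X_P)` already makes the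
off-diagonal entries of `r(X_P) = f(s(X_P))` nonpositive; so both sides hold for every `n`.

The function `f` is a Bernstein function, and the idea is that such functions preserve nonpositive
off-diagonal entries. Bernstein's integral representation is not needed. For `m ≥ 1` let
`y = (1 + s / m)⁻¹` be the resolvent and `sₘ = m - m y = s / (1 + s / m)` the Yosida approximation.

* Finite sections of `1 + s(X_P) / m` are Stieltjes matrices and have nonnegative inverses. The
  Galerkin approximations of `y p_j` built from them are nonnegative combinations of the `p_l`, and
  converge in `L²(μ)` because polynomials are dense in the form domain `L²((1 + s) dμ)`
  (`exists_nonneg_approx`). Hence all powers of `y(X_P)` are entrywise nonnegative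
  (`integral_resolventFun_pow_nonneg`).
* On `(0, m)` the function `f` is the sum of its Taylor series at `m`, whose coefficients in powers
  of `m - x` are nonpositive except for the constant one (`tendsto_taylorSum`, `coeff_nonpos`). With
  `m - sₘ = m y` this makes the off-diagonal entries of `f(sₘ)(X_P)` nonpositive
  (`integral_yosida_nonpos`).
* As `m → ∞`, `f ∘ sₘ` converges to `f ∘ s`, dominated by `f ∘ s`, which has finite moments since
  `f` grows at most linearly (`functionOfJacobi_comp_nonpos`).
-/

namespace OrthoConn

/-! ### Bernstein functions and their Taylor series -/

/-- `f` is a positive *Bernstein function*: positive and smooth on `(0, ∞)`, with completely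
monotonic derivative. -/
structure IsBernstein (f : ℝ → ℝ) : Prop where
  pos : ∀ x, 0 < x → 0 < f x
  contDiffOn : ContDiffOn ℝ ∞ f (Set.Ioi 0)
  sign : ∀ (k : ℕ) (x : ℝ), 0 < x → 0 ≤ (-1) ^ k * iteratedDeriv (k + 1) f x

theorem isBernstein_of_deriv {f : ℝ → ℝ} (hpos : ∀ x, 0 < x → 0 < f x)
    (hdiff : DifferentiableOn ℝ f (Set.Ioi 0)) (hf : IsCompletelyMonotonic (deriv f)) :
    IsBernstein f where
  pos := hpos
  contDiffOn := (contDiffOn_infty_iff_deriv_of_isOpen isOpen_Ioi).2 ⟨hdiff, hf.1⟩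
  sign k x hx := by
    rw [iteratedDeriv_succ']
    exact hf.2 k x hx

/-- The `n`-th Taylor polynomial of `f` with centre `c`, evaluated at `x`. -/
noncomputable def taylorSum (f : ℝ → ℝ) (c : ℝ) (n : ℕ) (x : ℝ) : ℝ :=
  ∑ k ∈ Finset.range (n + 1), iteratedDeriv k f c / k.factorial * (x - c) ^ k

/-- Taylor's theorem with the Cauchy form of the remainder, in terms of `iteratedDeriv`. -/
theorem exists_eq_taylorSum_add {f : ℝ → ℝ} (hf : ContDiffOn ℝ ∞ f (Set.Ioi 0)) {c x : ℝ}
    (hc : 0 < c) (hx : 0 < x) (hne : c ≠ x) (n : ℕ) :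
    ∃ ξ ∈ Set.uIoo c x, f x = taylorSum f c n x +
      iteratedDeriv (n + 1) f ξ * (x - ξ) ^ n / n.factorial * (x - c) := by
  have hsub : Set.uIcc c x ⊆ Set.Ioi 0 := fun t ht => (lt_min hc hx).trans_le ht.1
  have hu : UniqueDiffOn ℝ (Set.uIcc c x) := uniqueDiffOn_uIcc hne
  have hcd : ContDiffOn ℝ ∞ f (Set.uIcc c x) := hf.mono hsub
  have heq : ∀ (k : ℕ) (t : ℝ), t ∈ Set.uIcc c x →
      iteratedDerivWithin k f (Set.uIcc c x) t = iteratedDeriv k f t := by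
    intro k t ht
    rw [iteratedDeriv_eq_iteratedFDeriv, iteratedDerivWithin_eq_iteratedFDerivWithin,
      iteratedFDerivWithin_eq_iteratedFDeriv hu _ ht]
    exact (hf.contDiffAt (Ioi_mem_nhds (hsub ht))).of_le (mod_cast le_top)
  have hd : DifferentiableOn ℝ (iteratedDerivWithin n f (Set.uIcc c x)) (Set.uIcc c x) :=
    hcd.differentiableOn_iteratedDerivWithin (mod_cast ENat.natCast_lt_top n) hu
  obtain ⟨ξ, hξ, h⟩ := taylor_mean_remainder_cauchy hne (hcd.of_le (mod_cast le_top))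
    (hd.mono Set.Ioo_subset_Icc_self)
  refine ⟨ξ, hξ, ?_⟩
  rw [heq _ _ (Set.Ioo_subset_Icc_self hξ)] at h
  rw [← h, taylor_within_apply, taylorSum]
  have : ∀ k, iteratedDerivWithin k f (Set.uIcc c x) c = iteratedDeriv k f c :=
    fun k => heq k c Set.left_mem_uIcc
  simp only [this, smul_eq_mul]
  rw [add_comm, sub_add_eq_add_sub, eq_sub_iff_add_eq]
  congr 1
  exact Finset.sum_congr rfl fun k _ => by ring

namespace IsBernstein

variable {f : ℝ → ℝ}

theorem deriv_nonneg (hf : IsBernstein f) {x : ℝ} (hx : 0 < x) : 0 ≤ deriv f x := by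
  simpa using hf.sign 0 x hx

/-- The sign pattern of the Taylor coefficients of a Bernstein function: in powers of `c - x` all
coefficients but the constant one are nonpositive. -/
theorem coeff_nonpos (hf : IsBernstein f) {c t : ℝ} (hc : 0 < c) (ht : t ≤ 0) {k : ℕ}
    (hk : k ≠ 0) : iteratedDeriv k f c / k.factorial * t ^ k ≤ 0 := by
  obtain ⟨l, rfl⟩ := Nat.exists_eq_succ_of_ne_zero hk
  have h1 := hf.sign l c hc
  have h2 : t ^ (l + 1) = (-1) ^ l * (-((-t) ^ (l + 1))) := by
    rw [neg_pow t, pow_succ (-1 : ℝ) l]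
    have : ((-1 : ℝ) ^ l) * (-1) ^ l = 1 := by rw [← mul_pow]; norm_num
    linear_combination (-t ^ (l + 1)) * this
  have h3 : 0 ≤ (-t) ^ (l + 1) := pow_nonneg (by linarith) _
  have h4 : iteratedDeriv (l + 1) f c / (l + 1).factorial * t ^ (l + 1) =
      -(((-1) ^ l * iteratedDeriv (l + 1) f c) * (-t) ^ (l + 1) / (l + 1).factorial) := by
    rw [h2]; ring
  rw [Nat.succ_eq_add_one, h4, neg_nonpos]
  positivity

theorem monotone (hf : IsBernstein f) {x c : ℝ} (hx : 0 < x) (hxc : x ≤ c) : f x ≤ f c := by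
  rcases hxc.eq_or_lt with rfl | hlt
  · exact le_rfl
  obtain ⟨ξ, hξ, h⟩ := exists_eq_taylorSum_add hf.contDiffOn hx (hx.trans hlt) hlt.ne 0
  rw [Set.uIoo_of_lt hlt] at hξ
  have := hf.deriv_nonneg (hx.trans hξ.1)
  simp only [taylorSum, zero_add, Finset.range_one, Finset.sum_singleton, iteratedDeriv_zero,
    iteratedDeriv_one, pow_zero, Nat.factorial_zero, Nat.cast_one, div_one, mul_one] at h
  nlinarith

/-- A Bernstein function grows at most linearly. -/
theorem le_linear (hf : IsBernstein f) {x : ℝ} (hx : 0 < x) :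
    f x ≤ (f 1 + deriv f 1) * (1 + x) := by
  have h0 := hf.pos 1 one_pos
  have h1 := hf.deriv_nonneg one_pos
  rcases eq_or_ne 1 x with rfl | hne
  · nlinarith
  obtain ⟨ξ, hξ, h⟩ := exists_eq_taylorSum_add hf.contDiffOn one_pos hx hne 1
  have hξ0 : 0 < ξ := (lt_min one_pos hx).trans hξ.1
  have h2 : iteratedDeriv 2 f ξ ≤ 0 := by simpa using hf.sign 1 ξ hξ0
  have h3 : 0 ≤ (x - ξ) * (x - 1) := by
    rcases hne.lt_or_gt with hlt | hlt
    · rw [Set.uIoo_of_lt hlt] at hξ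
      exact mul_nonneg (by linarith [hξ.2]) (by linarith)
    · rw [Set.uIoo_of_gt hlt] at hξ
      exact mul_nonneg_of_nonpos_of_nonpos (by linarith [hξ.1]) (by linarith)
  simp only [taylorSum, Finset.sum_range_succ, Finset.range_zero, Finset.sum_empty, zero_add,
    iteratedDeriv_zero, iteratedDeriv_one, pow_zero, pow_one, Nat.factorial_zero,
    Nat.factorial_one, Nat.cast_one, div_one, mul_one, Nat.reduceAdd] at h
  nlinarith

theorem le_taylorSum (hf : IsBernstein f) {x c : ℝ} (hx : 0 < x) (hxc : x < c) (n : ℕ) :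
    f x ≤ taylorSum f c n x := by
  obtain ⟨ξ, hξ, h⟩ := exists_eq_taylorSum_add hf.contDiffOn (hx.trans hxc) hx hxc.ne' n
  rw [Set.uIoo_of_gt hxc] at hξ
  have h1 := hf.sign n ξ (hx.trans hξ.1)
  have h2 : 0 ≤ (ξ - x) ^ n := pow_nonneg (by linarith [hξ.1]) _
  have h3 : (x - ξ) ^ n = (-1) ^ n * (ξ - x) ^ n := by rw [← mul_pow]; ring
  have h4 : iteratedDeriv (n + 1) f ξ * (x - ξ) ^ n / n.factorial * (x - c) =
      -(((-1) ^ n * iteratedDeriv (n + 1) f ξ) * (ξ - x) ^ n / n.factorial * (c - x)) := by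
    rw [h3]; ring
  have h5 : 0 ≤ ((-1) ^ n * iteratedDeriv (n + 1) f ξ) * (ξ - x) ^ n / n.factorial * (c - x) := by
    have : 0 ≤ c - x := by linarith
    positivity
  linarith

/-- All terms but the constant one are nonpositive, so that those between the constant and the
last one may be dropped. -/
theorem taylorSum_le_add (hf : IsBernstein f) {x c : ℝ} (hc : 0 < c) (hxc : x ≤ c) (n : ℕ) :
    taylorSum f c (n + 1) x ≤
      f c + iteratedDeriv (n + 1) f c / (n + 1).factorial * (x - c) ^ (n + 1) := by
  rw [taylorSum, Finset.sum_range_succ, Finset.sum_range_succ']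
  have : ∑ k ∈ Finset.range n,
      iteratedDeriv (k + 1) f c / (k + 1).factorial * (x - c) ^ (k + 1) ≤ 0 :=
    Finset.sum_nonpos fun k _ => hf.coeff_nonpos hc (by linarith) k.add_one_ne_zero
  simp only [iteratedDeriv_zero, Nat.factorial_zero, Nat.cast_one, div_one, pow_zero, mul_one]
  linarith

theorem taylorSum_le (hf : IsBernstein f) {x c : ℝ} (hc : 0 < c) (hxc : x ≤ c) (n : ℕ) :
    taylorSum f c n x ≤ f c := by
  cases n with
  | zero => simp [taylorSum]
  | succ n =>
    linarith [hf.taylorSum_le_add hc hxc n,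
      hf.coeff_nonpos hc (sub_nonpos.2 hxc) n.add_one_ne_zero]

/-- The Cauchy estimate that the sign pattern gives: every Taylor term at `ξ`, taken at a point of
`(0, ξ)`, is bounded by `f ξ`. -/
theorem abs_iteratedDeriv_le (hf : IsBernstein f) {b ξ : ℝ} (hb : 0 < b) (hbξ : b < ξ) (n : ℕ) :
    |iteratedDeriv (n + 1) f ξ| * (ξ - b) ^ (n + 1) ≤ f ξ * (n + 1).factorial := by
  have h1 := (hf.le_taylorSum hb hbξ (n + 1)).trans
    (hf.taylorSum_le_add (hb.trans hbξ) hbξ.le n)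
  have h2 := hf.pos b hb
  have h3 := hf.coeff_nonpos (hb.trans hbξ) (sub_nonpos.2 hbξ.le) n.add_one_ne_zero
  have h4 : |iteratedDeriv (n + 1) f ξ| * (ξ - b) ^ (n + 1) / (n + 1).factorial =
      |iteratedDeriv (n + 1) f ξ / (n + 1).factorial * (b - ξ) ^ (n + 1)| := by
    rw [abs_mul, abs_div, abs_pow, abs_of_neg (sub_neg.2 hbξ), neg_sub, Nat.abs_cast]; ring
  rw [← div_le_iff₀ (by positivity), h4, abs_of_nonpos h3]
  linarith

/-- The Taylor series of a Bernstein function at `c` converges to it on `(0, c)`. The Cauchy form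
of the remainder is needed: the Lagrange form would give convergence on `(c / 2, c)` only. -/
theorem tendsto_taylorSum (hf : IsBernstein f) {x c : ℝ} (hx : 0 < x) (hxc : x < c) :
    Filter.Tendsto (fun n => taylorSum f c n x) Filter.atTop (nhds (f x)) := by
  -- the Cauchy estimates are taken at the point `x / 2`, which leaves the ratio `ρ < 1`
  set ρ : ℝ := (c - x) / (c - x / 2) with hρ
  have hcb : 0 < c - x / 2 := by linarith
  have hρ0 : 0 ≤ ρ := div_nonneg (by linarith) hcb.le
  have hρ1 : ρ < 1 := (div_lt_one hcb).2 (by linarith)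
  have hfc := hf.pos c (hx.trans hxc)
  set K : ℝ := f c * (c - x) / (x / 2) with hK
  have hbound : ∀ n : ℕ, taylorSum f c n x ≤ f x + K * (n * ρ ^ n + ρ ^ n) := by
    intro n
    obtain ⟨ξ, hξ, h⟩ := exists_eq_taylorSum_add hf.contDiffOn (hx.trans hxc) hx hxc.ne' n
    rw [Set.uIoo_of_gt hxc] at hξ
    obtain ⟨hξ1, hξ2⟩ := hξ
    have hξb : 0 < ξ - x / 2 := by linarith
    have hD := hf.abs_iteratedDeriv_le (half_pos hx) (by linarith : x / 2 < ξ) n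
    have hfξ : f ξ ≤ f c := hf.monotone (hx.trans hξ1) hξ2.le
    have hq : (ξ - x) / (ξ - x / 2) ≤ ρ := by
      rw [hρ, div_le_div_iff₀ hξb hcb]; nlinarith
    have hq0 : 0 ≤ (ξ - x) / (ξ - x / 2) := div_nonneg (by linarith) hξb.le
    have hDn : |iteratedDeriv (n + 1) f ξ| / n.factorial ≤
        f c * (n + 1) / (ξ - x / 2) ^ (n + 1) := by
      rw [div_le_div_iff₀ (by positivity) (by positivity)]
      calc _ ≤ f ξ * (n + 1).factorial := hD
        _ ≤ f c * (n + 1).factorial := by gcongr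
        _ = _ := by rw [Nat.factorial_succ]; push_cast; ring
    have hrem : |iteratedDeriv (n + 1) f ξ * (x - ξ) ^ n / n.factorial * (x - c)| ≤
        K * (n * ρ ^ n + ρ ^ n) := by
      have e1 : |x - ξ| = ξ - x := by rw [abs_sub_comm, abs_of_pos (by linarith)]
      have e2 : |x - c| = c - x := by rw [abs_sub_comm, abs_of_pos (by linarith)]
      calc |iteratedDeriv (n + 1) f ξ * (x - ξ) ^ n / n.factorial * (x - c)|
          = |iteratedDeriv (n + 1) f ξ| / n.factorial * ((ξ - x) ^ n * (c - x)) := by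
            rw [abs_mul, abs_div, abs_mul, abs_pow, e1, e2, Nat.abs_cast]; ring
        _ ≤ f c * (n + 1) / (ξ - x / 2) ^ (n + 1) * ((ξ - x) ^ n * (c - x)) := by
            have : 0 ≤ (ξ - x) ^ n * (c - x) :=
              mul_nonneg (pow_nonneg (by linarith) _) (by linarith)
            gcongr
        _ = f c * (c - x) / (ξ - x / 2) * ((n + 1) * ((ξ - x) / (ξ - x / 2)) ^ n) := by
            have hd := hξb.ne'
            rw [div_pow, pow_succ]
            generalize ξ - x / 2 = d at hd
            field_simp
        _ ≤ K * ((n + 1) * ρ ^ n) := by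
            have h0 : 0 ≤ f c * (c - x) := mul_nonneg hfc.le (by linarith)
            have h1 : f c * (c - x) / (ξ - x / 2) ≤ K := by
              rw [hK]; gcongr; linarith
            have : 0 ≤ f c * (c - x) / (ξ - x / 2) := div_nonneg h0 hξb.le
            gcongr
        _ = _ := by ring
    linarith [neg_abs_le (iteratedDeriv (n + 1) f ξ * (x - ξ) ^ n / n.factorial * (x - c))]
  have hlim : Filter.Tendsto (fun n : ℕ => f x + K * (n * ρ ^ n + ρ ^ n)) Filter.atTop
      (nhds (f x)) := by
    have := ((tendsto_self_mul_const_pow_of_lt_one hρ0 hρ1).add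
      (tendsto_pow_atTop_nhds_zero_of_lt_one hρ0 hρ1)).const_mul K |>.const_add (f x)
    simpa using this
  exact tendsto_of_tendsto_of_tendsto_of_le_of_le tendsto_const_nhds hlim
    (fun n => hf.le_taylorSum hx hxc n) hbound

end IsBernstein

/-! ### Stieltjes matrices and triangular M-matrices -/

open Matrix in
/-- A Stieltjes matrix has a nonnegative inverse: the negative part `b` of a solution of `A a = e`
with `e ≥ 0` satisfies `bᵀ A b ≤ 0`. -/
theorem nonneg_of_mulVec_nonneg {n : Type*} [Fintype n] {A : Matrix n n ℝ} (hA : A.PosDef)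
    (hoff : ∀ i j, i ≠ j → A i j ≤ 0) {a : n → ℝ} (h : ∀ i, 0 ≤ (A *ᵥ a) i) (i : n) :
    0 ≤ a i := by
  by_contra hneg
  set b : n → ℝ := fun i => (a i)⁻ with hb
  have hbne : b ≠ 0 := fun h0 => hneg (negPart_eq_zero.1 (congrFun h0 i))
  have hpos := hA.dotProduct_mulVec_pos hbne
  have h1 : 0 ≤ b ⬝ᵥ (A *ᵥ a) :=
    Finset.sum_nonneg fun i _ => mul_nonneg (negPart_nonneg _) (h i)
  have h2 : b ⬝ᵥ (A *ᵥ (fun i => (a i)⁺)) ≤ 0 := by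
    refine Finset.sum_nonpos fun i _ => ?_
    rw [mulVec, dotProduct, Finset.mul_sum]
    refine Finset.sum_nonpos fun j _ => ?_
    rcases eq_or_ne i j with rfl | hij
    · have : (a i)⁻ * (a i)⁺ = 0 := by
        rcases le_total 0 (a i) with h0 | h0
        · rw [negPart_eq_zero.2 h0, zero_mul]
        · rw [posPart_eq_zero.2 h0, mul_zero]
      exact le_of_eq (by linear_combination A i i * this)
    · exact mul_nonpos_of_nonneg_of_nonpos (negPart_nonneg _)
        (mul_nonpos_of_nonpos_of_nonneg (hoff i j hij) (posPart_nonneg _))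
  have h3 : a = (fun i => (a i)⁺) - b := by ext i; simp [hb, posPart_sub_negPart]
  rw [h3, mulVec_sub, dotProduct_sub] at h1
  simp only [star_trivial] at hpos
  linarith

/-- If the Cholesky product `Rᵀ R` has nonpositive off-diagonal entries, so has the factor `R`. -/
theorem upper_nonpos_of_gram_nonpos {R : ℕ → ℕ → ℝ} (hdiag : ∀ i, 0 < R i i)
    (hG : ∀ i j, i < j → ∑ k ∈ Finset.range (i + 1), R k i * R k j ≤ 0) :
    ∀ i j, i < j → R i j ≤ 0 := by
  intro i
  induction i using Nat.strong_induction_on with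
  | _ i ih =>
    intro j hij
    have h := hG i j hij
    rw [Finset.sum_range_succ] at h
    have h1 : 0 ≤ ∑ k ∈ Finset.range i, R k i * R k j := by
      refine Finset.sum_nonneg fun k hk => ?_
      have hk := Finset.mem_range.1 hk
      exact mul_nonneg_of_nonpos_of_nonpos (ih k hk i hk) (ih k hk j (hk.trans hij))
    have h2 : R i i * R i j ≤ 0 := by linarith
    exact nonpos_of_mul_nonpos_right h2 (hdiag i)

/-- For triangular matrices the spectral condition in the definition of an M-matrix says no more
than that the diagonal is positive. -/
theorem isMMatrix_of_isUpperTriangular {n : ℕ} {A : Matrix (Fin n) (Fin n) ℝ}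
    (hA : A.IsUpperTriangular) (hdiag : ∀ i, 0 < A i i) (hoff : ∀ i j, i ≠ j → A i j ≤ 0) :
    IsMMatrix A where
  diag_pos := hdiag
  offDiag_nonpos := hoff
  spectrum_pos z hz := by
    rw [Matrix.mem_spectrum_iff_isRoot_charpoly, Matrix.charpoly_map,
      Matrix.charpoly_of_isUpperTriangular _ hA, Polynomial.map_prod, Polynomial.IsRoot,
      Polynomial.eval_prod, Finset.prod_eq_zero_iff] at hz
    obtain ⟨i, -, hi⟩ := hz
    have : z = (A i i : ℂ) := by simpa [sub_eq_zero] using hi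
    simpa [this] using hdiag i

/-! ### Moments and the modified measure -/

theorem HasFiniteMoments.aestronglyMeasurable {μ : Measure ℝ} {g : ℝ → ℝ}
    (hg : HasFiniteMoments μ g) : AEStronglyMeasurable g μ := by
  simpa using (hg 0).aestronglyMeasurable

theorem HasFiniteMoments.integrable_eval_mul {μ : Measure ℝ} {g : ℝ → ℝ}
    (hg : HasFiniteMoments μ g) (P : ℝ[X]) : Integrable (fun x => P.eval x * g x) μ := by
  induction P using Polynomial.induction_on' with
  | add P Q hP hQ =>
    refine (hP.add hQ).congr (Filter.Eventually.of_forall fun x => ?_)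
    simp [add_mul]
  | monomial n a =>
    refine ((hg n).const_mul a).congr (Filter.Eventually.of_forall fun x => ?_)
    simp [mul_assoc]

theorem HasFiniteMoments.one_add_mul {μ : Measure ℝ} (hμ : HasFiniteMoments μ fun _ => 1)
    {s : ℝ → ℝ} (hs : HasFiniteMoments μ s) (c : ℝ) :
    HasFiniteMoments μ fun x => 1 + c * s x := by
  intro n
  refine ((hμ n).add ((hs n).const_mul c)).congr (Filter.Eventually.of_forall fun x => ?_)
  simp only [Pi.add_apply]
  ring

/-- The functional `P ↦ ∫ P g dμ` on polynomials. -/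
noncomputable def momentFunctional {μ : Measure ℝ} {g : ℝ → ℝ} (hg : HasFiniteMoments μ g) :
    ℝ[X] →ₗ[ℝ] ℝ where
  toFun P := ∫ x, P.eval x * g x ∂μ
  map_add' P Q := by
    rw [← integral_add (hg.integrable_eval_mul P) (hg.integrable_eval_mul Q)]
    simp [add_mul]
  map_smul' c P := by
    rw [RingHom.id_apply, smul_eq_mul, ← integral_const_mul]
    simp [mul_assoc]

theorem momentFunctional_apply {μ : Measure ℝ} {g : ℝ → ℝ} (hg : HasFiniteMoments μ g)
    (P : ℝ[X]) : momentFunctional hg P = ∫ x, P.eval x * g x ∂μ := rfl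

theorem integral_modifiedMeasure {μ : Measure ℝ} {r : ℝ → ℝ} (hr : AEMeasurable r μ)
    (hr0 : ∀ᵐ x ∂μ, 0 ≤ r x) (g : ℝ → ℝ) :
    ∫ x, g x ∂(modifiedMeasure μ r) = ∫ x, g x * r x ∂μ := by
  rw [modifiedMeasure, integral_withDensity_eq_integral_toReal_smul₀ hr.ennreal_ofReal
    (Filter.Eventually.of_forall fun _ => ENNReal.ofReal_lt_top)]
  refine integral_congr_ae ?_
  filter_upwards [hr0] with x hx
  rw [ENNReal.toReal_ofReal hx, smul_eq_mul, mul_comm]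

theorem integrable_modifiedMeasure_iff {μ : Measure ℝ} {r : ℝ → ℝ} (hr : AEMeasurable r μ)
    (hr0 : ∀ᵐ x ∂μ, 0 ≤ r x) (g : ℝ → ℝ) :
    Integrable g (modifiedMeasure μ r) ↔ Integrable (fun x => g x * r x) μ := by
  rw [modifiedMeasure, integrable_withDensity_iff_integrable_smul₀' hr.ennreal_ofReal
    (Filter.Eventually.of_forall fun _ => ENNReal.ofReal_lt_top)]
  refine integrable_congr ?_
  filter_upwards [hr0] with x hx
  rw [ENNReal.toReal_ofReal hx, smul_eq_mul, mul_comm]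

/-- Density of polynomials, with the squared distance written as an integral against `r dμ`. -/
theorem PolynomialsDense.exists_integral_sq_le {μ : Measure ℝ} {r : ℝ → ℝ}
    (hd : PolynomialsDense (modifiedMeasure μ r)) (hr : HasFiniteMoments μ r)
    (hr0 : ∀ᵐ x ∂μ, 0 ≤ r x) {u : ℝ → ℝ} (hum : AEStronglyMeasurable u μ)
    (hu : Integrable (fun x => u x ^ 2 * r x) μ) {ε : ℝ} (hε : 0 < ε) :
    ∃ h : ℝ[X], ∫ x, (u x - h.eval x) ^ 2 * r x ∂μ ≤ ε := by
  have hrm := hr.aestronglyMeasurable.aemeasurable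
  have hac : modifiedMeasure μ r ≪ μ := withDensity_absolutelyContinuous _ _
  have hu2 : MemLp u 2 (modifiedMeasure μ r) :=
    (memLp_two_iff_integrable_sq (hum.mono_ac hac)).2
      ((integrable_modifiedMeasure_iff hrm hr0 _).2 hu)
  obtain ⟨h, hh⟩ := hd u hu2 (ENNReal.ofReal (√ε)) (ENNReal.ofReal_pos.2 (Real.sqrt_pos.2 hε))
  refine ⟨h, ?_⟩
  have hi : Integrable (fun x => h.eval x ^ 2 * r x) μ :=
    (hr.integrable_eval_mul (h ^ 2)).congr (Filter.Eventually.of_forall fun x => by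
      simp only [Polynomial.eval_pow])
  have hh2 : MemLp (fun x => h.eval x) 2 (modifiedMeasure μ r) :=
    (memLp_two_iff_integrable_sq (by fun_prop)).2
      ((integrable_modifiedMeasure_iff hrm hr0 _).2
        hi)
  change eLpNorm (u - fun x => h.eval x) 2 _ < _ at hh
  rw [(hu2.sub hh2).eLpNorm_eq_integral_rpow_norm two_ne_zero ENNReal.ofNat_ne_top,
    ENNReal.ofReal_lt_ofReal_iff (Real.sqrt_pos.2 hε), Real.sqrt_eq_rpow] at hh
  simp only [ENNReal.toReal_ofNat, Real.rpow_ofNat, Pi.sub_apply, Real.norm_eq_abs, sq_abs,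
    ← one_div] at hh
  have := (Real.rpow_lt_rpow_iff (integral_nonneg fun x => sq_nonneg _) hε.le
    (by norm_num)).1 hh
  rw [integral_modifiedMeasure hrm hr0] at this
  exact this.le

/-! ### The resolvent of `s` -/

/-- A weight `s` on the orthogonality measure `μ` of `p` for which polynomials are dense in the
form domain `L²((1 + s) dμ)` and all finite sections of `s(X_P)` are Stieltjes matrices. -/
structure IsStieltjesWeight (μ : Measure ℝ) (p : ℕ → ℝ[X]) (s : ℝ → ℝ) : Prop where
  finite_moments : HasFiniteMoments μ fun _ => 1
  orthonormal : IsOrthonormalPolys μ p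
  pos : ∀ᵐ x ∂μ, 0 < s x
  weight_moments : HasFiniteMoments μ s
  dense : PolynomialsDense (modifiedMeasure μ fun x => 1 + s x)
  stieltjes : ∀ n, IsStieltjes (finiteSection (functionOfJacobi μ p s) n)

/-- The function `(1 + s / m)⁻¹`, the resolvent of multiplication by `s`. -/
noncomputable def resolventFun (s : ℝ → ℝ) (m : ℝ) (x : ℝ) : ℝ := (1 + m⁻¹ * s x)⁻¹

theorem IsOrthonormalPolys.exists_eq_sum {ν : Measure ℝ} {p : ℕ → ℝ[X]}
    (hp : IsOrthonormalPolys ν p) (h : ℝ[X]) :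
    ∃ c : ℕ →₀ ℝ, h = c.sum fun i a => a • p i := by
  have hspan := Polynomial.Sequence.span (⟨p, hp.degree_eq⟩ : Polynomial.Sequence ℝ) (fun i =>
    isUnit_iff_ne_zero.2 (leadingCoeff_ne_zero.2 (Polynomial.Sequence.ne_zero _ i)))
  have hmem : h ∈ Submodule.span ℝ (Set.range p) := by
    change Submodule.span ℝ (Set.range p) = ⊤ at hspan
    rw [hspan]; trivial
  obtain ⟨c, hc⟩ := Finsupp.mem_span_range_iff_exists_finsupp.1 hmem
  exact ⟨c, hc.symm⟩

namespace IsStieltjesWeight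

variable {μ : Measure ℝ} {p : ℕ → ℝ[X]} {s : ℝ → ℝ}

theorem resolventFun_mem (hw : IsStieltjesWeight μ p s) {m : ℝ} (hm : 0 < m) :
    ∀ᵐ x ∂μ, 0 < resolventFun s m x ∧ resolventFun s m x < 1 := by
  filter_upwards [hw.pos] with x hx
  have : 0 < m⁻¹ * s x := by positivity
  exact ⟨inv_pos.2 (by linarith), inv_lt_one_of_one_lt₀ (by linarith)⟩

theorem aestronglyMeasurable_resolventFun (hw : IsStieltjesWeight μ p s) (m : ℝ) :
    AEStronglyMeasurable (resolventFun s m) μ :=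
  ((hw.weight_moments.aestronglyMeasurable.aemeasurable.const_mul m⁻¹).const_add
    1).inv.aestronglyMeasurable

theorem integrable_mul_resolventFun_pow (hw : IsStieltjesWeight μ p s) {m : ℝ} (hm : 0 < m)
    {g : ℝ → ℝ} (hg : Integrable g μ) (k : ℕ) :
    Integrable (fun x => resolventFun s m x ^ k * g x) μ := by
  refine hg.bdd_mul (c := 1) ((hw.aestronglyMeasurable_resolventFun m).pow k) ?_
  filter_upwards [hw.resolventFun_mem hm] with x hx
  rw [norm_pow, Real.norm_eq_abs, abs_of_pos hx.1]
  exact pow_le_one₀ hx.1.le hx.2.le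

theorem integrable_eval (hw : IsStieltjesWeight μ p s) (P : ℝ[X]) :
    Integrable (fun x => P.eval x) μ := by
  simpa using hw.finite_moments.integrable_eval_mul P

/-- The Galerkin equations for `(1 + s / m) u = p j` in the span of `p 0, …, p (n - 1)` have a
solution with nonnegative coefficients, because their matrix is a Stieltjes matrix. -/
theorem exists_nonneg_galerkin (hw : IsStieltjesWeight μ p s) {m : ℝ} (hm : 0 < m) {n j : ℕ}
    (hj : j < n) :
    ∃ a : Fin n → ℝ, (∀ l, 0 ≤ a l) ∧ ∀ i < n,
      ∫ x, ((∑ l, a l • p l) * p i).eval x * (1 + m⁻¹ * s x) ∂μ =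
        ∫ x, (p j * p i).eval x ∂μ := by
  have hmom := hw.finite_moments.one_add_mul hw.weight_moments m⁻¹
  set S := finiteSection (functionOfJacobi μ p s) n with hS
  have hSt := (isStieltjes_iff _).1 (hw.stieltjes n)
  set A : Matrix (Fin n) (Fin n) ℝ := 1 + m⁻¹ • S with hA
  have hApos : A.PosDef := Matrix.PosDef.one.add (hSt.1.smul (inv_pos.2 hm))
  have hAoff : ∀ i l, i ≠ l → A i l ≤ 0 := by
    intro i l hil
    have := hSt.2 i l hil
    have h0 : 0 < m⁻¹ := inv_pos.2 hm
    rw [hA, Matrix.add_apply, Matrix.one_apply_ne hil, zero_add, Matrix.smul_apply, smul_eq_mul]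
    exact mul_nonpos_of_nonneg_of_nonpos h0.le this
  have hAB : ∀ i l : Fin n, A i l = momentFunctional hmom (p l * p i) := by
    intro i l
    rw [momentFunctional_apply, hA, Matrix.add_apply, Matrix.smul_apply, smul_eq_mul, hS,
      finiteSection, Matrix.submatrix_apply, functionOfJacobi, Matrix.of_apply]
    have h1 := hw.orthonormal.orthonormal i l
    have h2 : (1 : Matrix (Fin n) (Fin n) ℝ) i l = ∫ x, (p i).eval x * (p l).eval x ∂μ := by
      rw [h1, Matrix.one_apply]
      simp only [Fin.ext_iff]
    rw [h2, ← integral_const_mul, ← integral_add]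
    · refine integral_congr_ae (Filter.Eventually.of_forall fun x => ?_)
      simp only [eval_mul]
      ring
    · simpa using hw.integrable_eval (p i * p l)
    · refine ((hw.weight_moments.integrable_eval_mul (p i * p l)).const_mul m⁻¹).congr
        (Filter.Eventually.of_forall fun x => ?_)
      simp only [eval_mul]
      ring
  have hdet : IsUnit A.det := (Matrix.isUnit_iff_isUnit_det A).1 hApos.isUnit
  set e : Fin n → ℝ := Pi.single ⟨j, hj⟩ 1 with he
  have hAa : A.mulVec (A⁻¹.mulVec e) = e := by
    rw [Matrix.mulVec_mulVec, Matrix.mul_nonsing_inv _ hdet, Matrix.one_mulVec]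
  refine ⟨A⁻¹.mulVec e, fun l => nonneg_of_mulVec_nonneg hApos hAoff (fun i => ?_) l,
    fun i hi => ?_⟩
  · rw [hAa, he, Pi.single_apply]
    split_ifs <;> norm_num
  · have h1 := congrFun hAa ⟨i, hi⟩
    rw [← momentFunctional_apply hmom, Finset.sum_mul, map_sum]
    simp only [smul_mul_assoc, map_smul, smul_eq_mul, eval_mul]
    rw [hw.orthonormal.orthonormal j i]
    rw [Matrix.mulVec, dotProduct] at h1
    simp only [hAB] at h1
    rw [he, Pi.single_apply] at h1
    simp only [Fin.mk.injEq, eq_comm (a := i)] at h1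
    rw [← h1]
    exact Finset.sum_congr rfl fun l _ => mul_comm _ _

/-- The resolvent maps each `p j` to an `L²(μ)`-limit of nonnegative combinations of the `p l`.
The Galerkin solution is the best approximation in `L²((1 + s / m) dμ)`, where density of
polynomials bounds its error. -/
theorem exists_nonneg_approx (hw : IsStieltjesWeight μ p s) {m : ℝ} (hm : 1 ≤ m) (j : ℕ)
    {ε : ℝ} (hε : 0 < ε) :
    ∃ (n : ℕ) (a : Fin n → ℝ), (∀ l, 0 ≤ a l) ∧
      ∫ x, (resolventFun s m x * (p j).eval x - (∑ l, a l • p l).eval x) ^ 2 ∂μ ≤ ε := by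
  have hm0 : 0 < m := one_pos.trans_le hm
  have hmom := hw.finite_moments.one_add_mul hw.weight_moments m⁻¹
  have hmom1 : HasFiniteMoments μ fun x => 1 + s x := by
    simpa using hw.finite_moments.one_add_mul hw.weight_moments 1
  have hym := hw.aestronglyMeasurable_resolventFun m
  set y := resolventFun s m with hy
  set u : ℝ → ℝ := fun x => y x * (p j).eval x with hu
  have hum : AEStronglyMeasurable u μ := hym.mul (by fun_prop)
  have huw : ∀ᵐ x ∂μ, u x * (1 + m⁻¹ * s x) = (p j).eval x := by
    filter_upwards [hw.pos] with x hx
    have : 0 < 1 + m⁻¹ * s x := by positivity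
    simp only [hu, hy, resolventFun]
    field_simp
  have hu2 : Integrable (fun x => u x ^ 2 * (1 + s x)) μ := by
    refine (hw.integrable_mul_resolventFun_pow hm0
      (hmom1.integrable_eval_mul (p j ^ 2)) 2).congr (Filter.Eventually.of_forall fun x => ?_)
    simp only [hu, ← hy, eval_pow]
    ring
  obtain ⟨h, hh⟩ := hw.dense.exists_integral_sq_le hmom1
    (by filter_upwards [hw.pos] with x hx; linarith) hum hu2 hε
  obtain ⟨c, hc⟩ := hw.orthonormal.exists_eq_sum h
  obtain ⟨n, hcn⟩ : ∃ n, j < n ∧ ∀ i ∈ c.support, i < n := by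
    refine ⟨max j (c.support.sup id) + 1, by omega, fun i hi => ?_⟩
    have : i ≤ c.support.sup id := Finset.le_sup (f := id) hi
    omega
  obtain ⟨a, ha0, ha⟩ := hw.exists_nonneg_galerkin hm0 hcn.1
  refine ⟨n, a, ha0, ?_⟩
  set U : ℝ[X] := ∑ l, a l • p l with hU
  -- polynomials times `u` times the weight are polynomials almost everywhere
  have hint1 : ∀ P : ℝ[X], Integrable (fun x => (u x - U.eval x) * P.eval x * (1 + m⁻¹ * s x)) μ
      ∧ ∫ x, (u x - U.eval x) * P.eval x * (1 + m⁻¹ * s x) ∂μ =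
        momentFunctional hw.finite_moments (p j * P) - momentFunctional hmom (U * P) := by
    intro P
    have hae : (fun x => (p j * P).eval x * 1 - (U * P).eval x * (1 + m⁻¹ * s x)) =ᵐ[μ]
        fun x => (u x - U.eval x) * P.eval x * (1 + m⁻¹ * s x) := by
      filter_upwards [huw] with x hx
      rw [eval_mul, ← hx, eval_mul]
      ring
    have i1 := hw.finite_moments.integrable_eval_mul (p j * P)
    have i2 := hmom.integrable_eval_mul (U * P)
    exact ⟨(i1.sub i2).congr hae, by
      rw [← integral_congr_ae hae, integral_sub i1 i2]; rfl⟩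
  -- Galerkin orthogonality
  have horth : ∀ i < n, momentFunctional hw.finite_moments (p j * p i) -
      momentFunctional hmom (U * p i) = 0 := by
    intro i hi
    rw [momentFunctional_apply, momentFunctional_apply, ha i hi]
    simp
  have horthU : ∫ x, (u x - U.eval x) * (U - h).eval x * (1 + m⁻¹ * s x) ∂μ = 0 := by
    rw [(hint1 _).2]
    have hlin : ∀ P Q : ℝ[X], momentFunctional hw.finite_moments (p j * (P - Q)) -
        momentFunctional hmom (U * (P - Q)) =
        (momentFunctional hw.finite_moments (p j * P) - momentFunctional hmom (U * P)) -
        (momentFunctional hw.finite_moments (p j * Q) - momentFunctional hmom (U * Q)) := by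
      intro P Q
      rw [mul_sub, mul_sub, map_sub, map_sub]; ring
    have hsum : ∀ (t : Finset ℕ) (b : ℕ → ℝ), (∀ i ∈ t, i < n) →
        momentFunctional hw.finite_moments (p j * ∑ i ∈ t, b i • p i) -
          momentFunctional hmom (U * ∑ i ∈ t, b i • p i) = 0 := by
      intro t b ht
      simp only [Finset.mul_sum, map_sum, mul_smul_comm, map_smul, smul_eq_mul]
      rw [← Finset.sum_sub_distrib]
      refine Finset.sum_eq_zero fun i hi => ?_
      rw [← mul_sub, horth i (ht i hi), mul_zero]
    have hUr : U = ∑ i ∈ Finset.range n, (if hi : i < n then a ⟨i, hi⟩ else 0) • p i := by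
      rw [hU, ← Fin.sum_univ_eq_sum_range (fun i => (if hi : i < n then a ⟨i, hi⟩ else 0) • p i)]
      simp
    have hsumU := hsum (Finset.range n) (fun i => if hi : i < n then a ⟨i, hi⟩ else 0)
      fun i hi => Finset.mem_range.1 hi
    rw [← hUr] at hsumU
    rw [hlin, hc, Finsupp.sum, hsum _ _ hcn.2, hsumU, sub_zero]
  have hsq : ∀ P : ℝ[X], Integrable (fun x => (u x - P.eval x) ^ 2 * (1 + s x)) μ := by
    intro P
    have i3 := hmom1.integrable_eval_mul (P ^ 2)
    have i4 := hw.integrable_mul_resolventFun_pow hm0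
      (hmom1.integrable_eval_mul (p j * P)) 1
    refine ((hu2.sub (i4.const_mul 2)).add i3).congr (Filter.Eventually.of_forall fun x => ?_)
    simp only [hu, ← hy, eval_pow, eval_mul, Pi.add_apply, Pi.sub_apply]
    ring
  have hle : ∀ᵐ x ∂μ, 1 ≤ 1 + m⁻¹ * s x ∧ 1 + m⁻¹ * s x ≤ 1 + s x := by
    filter_upwards [hw.pos] with x hx
    have h1 : m⁻¹ ≤ 1 := inv_le_one_of_one_le₀ hm
    have h2 : 0 < m⁻¹ := inv_pos.2 hm0
    exact ⟨by nlinarith, by nlinarith⟩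
  have hwm := hmom.aestronglyMeasurable
  have hsqw : ∀ P : ℝ[X], Integrable (fun x => (u x - P.eval x) ^ 2 * (1 + m⁻¹ * s x)) μ := by
    intro P
    refine (hsq P).mono' (((hum.sub (by fun_prop)).pow 2).mul hwm) ?_
    filter_upwards [hle] with x hx
    rw [Real.norm_eq_abs, abs_of_nonneg (mul_nonneg (sq_nonneg _) (by linarith [hx.1]))]
    exact mul_le_mul_of_nonneg_left hx.2 (sq_nonneg _)
  have hsq1 : Integrable (fun x => (u x - U.eval x) ^ 2) μ := by
    refine (hsqw U).mono' ((hum.sub (by fun_prop)).pow 2) ?_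
    filter_upwards [hle] with x hx
    rw [Real.norm_eq_abs, abs_of_nonneg (sq_nonneg _)]
    exact le_mul_of_one_le_right (sq_nonneg _) hx.1
  calc ∫ x, (u x - U.eval x) ^ 2 ∂μ
      ≤ ∫ x, (u x - U.eval x) ^ 2 * (1 + m⁻¹ * s x) ∂μ := by
        refine integral_mono_ae hsq1 (hsqw U) ?_
        filter_upwards [hle] with x hx
        exact le_mul_of_one_le_right (sq_nonneg _) hx.1
    _ = ∫ x, ((u x - U.eval x) ^ 2 * (1 + m⁻¹ * s x) +
          2 * ((u x - U.eval x) * (U - h).eval x * (1 + m⁻¹ * s x))) ∂μ := by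
        rw [integral_add (hsqw U) ((hint1 _).1.const_mul 2), integral_const_mul, horthU]
        ring
    _ ≤ ∫ x, (u x - h.eval x) ^ 2 * (1 + s x) ∂μ := by
        refine integral_mono_ae ((hsqw U).add ((hint1 _).1.const_mul 2)) (hsq h) ?_
        filter_upwards [hle] with x hx
        refine le_trans ?_ (mul_le_mul_of_nonneg_left hx.2 (sq_nonneg _))
        rw [eval_sub]
        have : 0 ≤ (U.eval x - h.eval x) ^ 2 * (1 + m⁻¹ * s x) :=
          mul_nonneg (sq_nonneg _) (by linarith [hx.1])
        nlinarith
    _ ≤ ε := hh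

end IsStieltjesWeight

/-! ### Bernstein functions of the Jacobi matrix -/

theorem IsBernstein.aestronglyMeasurable_comp {μ : Measure ℝ} {f : ℝ → ℝ} (hf : IsBernstein f)
    {t : ℝ → ℝ} (ht : AEStronglyMeasurable t μ) (ht0 : ∀ᵐ x ∂μ, 0 < t x) :
    AEStronglyMeasurable (fun x => f (t x)) μ := by
  -- `f` need not be measurable off `(0, ∞)`; almost everywhere `t = exp (log t)`
  have hc : Continuous fun z : ℝ => f (Real.exp z) :=
    hf.contDiffOn.continuousOn.comp_continuous Real.continuous_exp fun z => Real.exp_pos z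
  refine (hc.comp_aestronglyMeasurable
    (Real.measurable_log.comp_aemeasurable ht.aemeasurable).aestronglyMeasurable).congr ?_
  filter_upwards [ht0] with x hx
  simp [Real.exp_log hx]

namespace IsStieltjesWeight

variable {μ : Measure ℝ} {p : ℕ → ℝ[X]} {s : ℝ → ℝ}

/-- The powers of the resolvent of `s(X_P)` are entrywise nonnegative. -/
theorem integral_resolventFun_pow_nonneg (hw : IsStieltjesWeight μ p s) {m : ℝ} (hm : 1 ≤ m)
    (k i j : ℕ) : 0 ≤ ∫ x, resolventFun s m x ^ k * ((p i).eval x * (p j).eval x) ∂μ := by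
  have hm0 : 0 < m := one_pos.trans_le hm
  induction k generalizing j with
  | zero =>
    simp only [pow_zero, one_mul, hw.orthonormal.orthonormal]
    split_ifs <;> norm_num
  | succ k ih =>
    refine le_of_forall_pos_le_add fun η hη => ?_
    obtain ⟨n, a, ha0, ha⟩ := hw.exists_nonneg_approx hm j (pow_pos hη 2)
    have hy := hw.resolventFun_mem hm0
    have hym := hw.aestronglyMeasurable_resolventFun m
    set y := resolventFun s m with hydef
    have hint : ∀ (k : ℕ) (P : ℝ[X]), Integrable (fun x => y x ^ k * P.eval x) μ :=
      fun k P => hw.integrable_mul_resolventFun_pow hm0 (hw.integrable_eval P) k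
    set U : ℝ[X] := ∑ l, a l • p l with hU
    have hUnonneg : 0 ≤ ∫ x, y x ^ k * (p i * U).eval x ∂μ := by
      have h1 : ∀ x, y x ^ k * (p i * U).eval x =
          ∑ l : Fin n, a l * (y x ^ k * ((p i).eval x * (p l).eval x)) := by
        intro x
        rw [hU, eval_mul, eval_finsetSum, Finset.mul_sum, Finset.mul_sum]
        refine Finset.sum_congr rfl fun l _ => ?_
        rw [eval_smul, smul_eq_mul]; ring
      simp only [h1]
      rw [integral_finsetSum]
      · refine Finset.sum_nonneg fun l _ => ?_
        rw [integral_const_mul]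
        exact mul_nonneg (ha0 l) (ih l)
      · intro l _
        have := (hint k (p i * p l)).const_mul (a l)
        simpa only [eval_mul] using this
    have hD : Integrable (fun x => (y x * (p j).eval x - U.eval x) ^ 2) μ := by
      refine (((hint 2 (p j ^ 2)).sub ((hint 1 (p j * U)).const_mul 2)).add (hint 0 (U ^ 2))).congr
        (Filter.Eventually.of_forall fun x => ?_)
      simp only [Pi.add_apply, Pi.sub_apply, eval_pow, eval_mul]
      ring
    have hp2 : Integrable (fun x => (p i).eval x ^ 2) μ :=
      (hw.integrable_eval (p i ^ 2)).congr (Filter.Eventually.of_forall fun x => by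
        simp only [Polynomial.eval_pow])
    have hp2v : ∫ x, (p i).eval x ^ 2 ∂μ = 1 := by
      simpa [sq] using hw.orthonormal.orthonormal i i
    have herr : Integrable (fun x => η / 2 * (p i).eval x ^ 2 +
        (2 * η)⁻¹ * (y x * (p j).eval x - U.eval x) ^ 2) μ :=
      (hp2.const_mul _).add (hD.const_mul _)
    have hlow : Integrable (fun x => y x ^ k * (p i * U).eval x -
        (η / 2 * (p i).eval x ^ 2 + (2 * η)⁻¹ * (y x * (p j).eval x - U.eval x) ^ 2)) μ :=
      (hint k (p i * U)).sub herr
    have hup : Integrable (fun x => y x ^ (k + 1) * ((p i).eval x * (p j).eval x)) μ := by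
      simpa only [eval_mul] using hint (k + 1) (p i * p j)
    have hcmp : ∫ x, (y x ^ k * (p i * U).eval x -
        (η / 2 * (p i).eval x ^ 2 + (2 * η)⁻¹ * (y x * (p j).eval x - U.eval x) ^ 2)) ∂μ ≤
        ∫ x, y x ^ (k + 1) * ((p i).eval x * (p j).eval x) ∂μ := by
      refine integral_mono_ae hlow hup ?_
      filter_upwards [hy] with x hx
      -- Young's inequality for the product of `y ^ k * p i` and the approximation error
      set d := y x * (p j).eval x - U.eval x with hd
      have hk0 : 0 ≤ y x ^ k := pow_nonneg hx.1.le _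
      have hk1 : y x ^ k ≤ 1 := pow_le_one₀ hx.1.le hx.2.le
      have h1 : -(y x ^ k * ((p i).eval x * d)) ≤ |(p i).eval x| * |d| := by
        rw [← abs_mul]
        refine (neg_le_abs _).trans ?_
        rw [abs_mul, abs_of_nonneg hk0]
        exact mul_le_of_le_one_left (abs_nonneg _) hk1
      have h2 : |(p i).eval x| * |d| ≤ η / 2 * (p i).eval x ^ 2 + (2 * η)⁻¹ * d ^ 2 := by
        have h3 : 0 ≤ (2 * η)⁻¹ * (η * |(p i).eval x| - |d|) ^ 2 := by positivity
        have h4 : (2 * η)⁻¹ * (η * |(p i).eval x| - |d|) ^ 2 =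
            η / 2 * |(p i).eval x| ^ 2 + (2 * η)⁻¹ * |d| ^ 2 - |(p i).eval x| * |d| := by
          field_simp; ring
        rw [sq_abs, sq_abs] at h4
        linarith
      have h5 : y x ^ (k + 1) * ((p i).eval x * (p j).eval x) =
          y x ^ k * (p i * U).eval x + y x ^ k * ((p i).eval x * d) := by
        rw [hd, eval_mul]; ring
      rw [h5]
      linarith
    rw [integral_sub (hint k (p i * U)) herr,
      integral_add (hp2.const_mul _) (hD.const_mul _), integral_const_mul, integral_const_mul,
      hp2v] at hcmp
    have h6 : (2 * η)⁻¹ * ∫ x, (y x * (p j).eval x - U.eval x) ^ 2 ∂μ ≤ (2 * η)⁻¹ * η ^ 2 := by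
      gcongr
    have h7 : (2 * η)⁻¹ * η ^ 2 = η / 2 := by field_simp
    linarith

/-- The off-diagonal entries of `f(sₘ(X_P))` are nonpositive for the bounded Yosida approximation
`sₘ = s / (1 + s / m) = m - m y` of `s`, with `y` the resolvent: the Taylor series of `f` at `m`
has nonpositive coefficients in powers of `m y`. -/
theorem integral_yosida_nonpos (hw : IsStieltjesWeight μ p s) {f : ℝ → ℝ} (hf : IsBernstein f)
    {m : ℝ} (hm : 1 ≤ m) {i j : ℕ} (hij : i ≠ j) :
    ∫ x, f (m - m * resolventFun s m x) * ((p i).eval x * (p j).eval x) ∂μ ≤ 0 := by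
  have hm0 : 0 < m := one_pos.trans_le hm
  have hy := hw.resolventFun_mem hm0
  have hint : ∀ k : ℕ, Integrable
      (fun x => resolventFun s m x ^ k * ((p i).eval x * (p j).eval x)) μ := fun k => by
    simpa only [eval_mul] using
      hw.integrable_mul_resolventFun_pow hm0 (hw.integrable_eval (p i * p j)) k
  have hexp : ∀ (n : ℕ) (x : ℝ), taylorSum f m n (m - m * resolventFun s m x) *
      ((p i).eval x * (p j).eval x) = ∑ k ∈ Finset.range (n + 1),
      iteratedDeriv k f m / k.factorial * (-m) ^ k *
        (resolventFun s m x ^ k * ((p i).eval x * (p j).eval x)) := by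
    intro n x
    rw [taylorSum, Finset.sum_mul]
    refine Finset.sum_congr rfl fun k _ => ?_
    have : m - m * resolventFun s m x - m = -m * resolventFun s m x := by ring
    rw [this, mul_pow]
    ring
  have hmem : ∀ᵐ x ∂μ, 0 < m - m * resolventFun s m x ∧ m - m * resolventFun s m x < m := by
    filter_upwards [hy] with x hx
    exact ⟨by nlinarith [hx.2], by nlinarith [hx.1]⟩
  have hlim : Filter.Tendsto (fun n => ∫ x, taylorSum f m n (m - m * resolventFun s m x) *
      ((p i).eval x * (p j).eval x) ∂μ) Filter.atTop
      (nhds (∫ x, f (m - m * resolventFun s m x) * ((p i).eval x * (p j).eval x) ∂μ)) := by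
    refine tendsto_integral_of_dominated_convergence
      (fun x => f m * |(p i).eval x * (p j).eval x|) (fun n => ?_) ?_ (fun n => ?_) ?_
    · simp only [hexp]
      exact (integrable_finsetSum _ fun k _ => (hint k).const_mul _).aestronglyMeasurable
    · simpa using (hint 0).abs.const_mul (f m)
    · filter_upwards [hmem] with x hx
      rw [norm_mul, Real.norm_eq_abs, Real.norm_eq_abs, abs_of_pos
        ((hf.pos _ hx.1).trans_le (hf.le_taylorSum hx.1 hx.2 n))]
      exact mul_le_mul_of_nonneg_right (hf.taylorSum_le hm0 hx.2.le n) (abs_nonneg _)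
    · filter_upwards [hmem] with x hx
      exact (hf.tendsto_taylorSum hx.1 hx.2).mul_const _
  refine le_of_tendsto' hlim fun n => ?_
  simp only [hexp]
  rw [integral_finsetSum _ fun k _ => (hint k).const_mul _]
  refine Finset.sum_nonpos fun k _ => ?_
  rw [integral_const_mul]
  rcases eq_or_ne k 0 with rfl | hk
  · simp [hw.orthonormal.orthonormal, hij]
  · exact mul_nonpos_of_nonpos_of_nonneg (hf.coeff_nonpos hm0 (neg_nonpos.2 hm0.le) hk)
      (hw.integral_resolventFun_pow_nonneg hm k i j)

theorem hasFiniteMoments_comp (hw : IsStieltjesWeight μ p s) {f : ℝ → ℝ} (hf : IsBernstein f) :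
    HasFiniteMoments μ fun x => f (s x) := by
  intro n
  have hmom1 : HasFiniteMoments μ fun x => 1 + s x := by
    simpa using hw.finite_moments.one_add_mul hw.weight_moments 1
  refine ((hmom1 n).abs.const_mul (f 1 + deriv f 1)).mono'
    ((by fun_prop : AEStronglyMeasurable (fun x : ℝ => x ^ n) μ).mul
      (hf.aestronglyMeasurable_comp hw.weight_moments.aestronglyMeasurable hw.pos)) ?_
  filter_upwards [hw.pos] with x hx
  rw [norm_mul, Real.norm_eq_abs, Real.norm_eq_abs, abs_mul, abs_of_pos (hf.pos _ hx),
    abs_of_pos (by linarith : 0 < 1 + s x), mul_left_comm]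
  exact mul_le_mul_of_nonneg_left (hf.le_linear hx) (abs_nonneg _)

/-- A Bernstein function preserves nonpositivity of the off-diagonal entries. -/
theorem functionOfJacobi_comp_nonpos (hw : IsStieltjesWeight μ p s) {f : ℝ → ℝ}
    (hf : IsBernstein f) {i j : ℕ} (hij : i ≠ j) :
    functionOfJacobi μ p (f ∘ s) i j ≤ 0 := by
  have hlim : Filter.Tendsto (fun N : ℕ => ∫ x, f ((N + 1 : ℝ) -
      (N + 1 : ℝ) * resolventFun s (N + 1) x) * ((p i).eval x * (p j).eval x) ∂μ) Filter.atTop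
      (nhds (∫ x, f (s x) * ((p i).eval x * (p j).eval x) ∂μ)) := by
    have hyos : ∀ x, 0 < s x → ∀ m : ℝ, 0 < m →
        m - m * resolventFun s m x = s x * resolventFun s m x := by
      intro x hx m hm
      have : 0 < 1 + m⁻¹ * s x := by positivity
      have h2 : 0 < m + s x := by positivity
      simp only [resolventFun]
      field_simp
      ring
    have hN : ∀ N : ℕ, (0 : ℝ) < N + 1 := fun N => by positivity
    refine tendsto_integral_of_dominated_convergence
      (fun x => |(p i * p j).eval x * f (s x)|) (fun N => ?_) ?_ (fun N => ?_) ?_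
    · refine AEStronglyMeasurable.mul (hf.aestronglyMeasurable_comp
        (aestronglyMeasurable_const.sub
          ((hw.aestronglyMeasurable_resolventFun _).const_mul _)) ?_) (by fun_prop)
      filter_upwards [hw.resolventFun_mem (hN N)] with x hx
      nlinarith [hx.2, hN N]
    · exact ((hw.hasFiniteMoments_comp hf).integrable_eval_mul (p i * p j)).abs
    · filter_upwards [hw.resolventFun_mem (hN N), hw.pos] with x hx hs
      rw [hyos x hs _ (hN N), norm_mul, Real.norm_eq_abs, Real.norm_eq_abs, eval_mul,
        abs_of_pos (hf.pos _ (mul_pos hs hx.1)), abs_mul _ (f (s x)), abs_of_pos (hf.pos _ hs),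
        mul_comm]
      exact mul_le_mul_of_nonneg_left (hf.monotone (mul_pos hs hx.1)
        (mul_le_of_le_one_right hs.le hx.2.le)) (abs_nonneg _)
    · filter_upwards [hw.pos] with x hs
      refine Filter.Tendsto.mul_const _ ?_
      have h1 : Filter.Tendsto (fun N : ℕ => s x * resolventFun s (N + 1) x) Filter.atTop
          (nhds (s x)) := by
        have h2 : Filter.Tendsto (fun N : ℕ => ((N : ℝ) + 1)⁻¹) Filter.atTop (nhds 0) := by
          simpa using tendsto_one_div_add_atTop_nhds_zero_nat (𝕜 := ℝ)
        have h3 := (((h2.mul_const (s x)).const_add 1).inv₀ (by simp)).const_mul (s x)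
        simpa [resolventFun] using h3
      have h4 : ContinuousAt f (s x) := hf.contDiffOn.continuousOn.continuousAt (Ioi_mem_nhds hs)
      refine (h4.tendsto.comp h1).congr fun N => ?_
      rw [Function.comp_apply, hyos x hs _ (hN N)]
  have h := le_of_tendsto' hlim fun N =>
    hw.integral_yosida_nonpos hf (by linarith [N.cast_nonneg (α := ℝ)]) hij
  rw [functionOfJacobi, Matrix.of_apply]
  refine le_of_eq_of_le (integral_congr_ae (Filter.Eventually.of_forall fun x => ?_)) h
  simp only [Function.comp_apply]
  ring

end IsStieltjesWeight

/-! ### The connection matrix as a Cholesky factor -/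

theorem IsConnectionMatrix.diag_pos {p q : ℕ → ℝ[X]} {R : Matrix ℕ ℕ ℝ}
    (hR : IsConnectionMatrix p q R) (hp : ∀ n, (p n).degree = n) (hq : ∀ n, (q n).degree = n)
    (hsign : ∀ n, 0 < (p n).leadingCoeff * (q n).leadingCoeff) (n : ℕ) : 0 < R n n := by
  have hnat : ∀ {h : ℕ → ℝ[X]}, (∀ n, (h n).degree = n) → ∀ n, (h n).natDegree = n :=
    fun hh n => natDegree_eq_of_degree_eq_some (hh n)
  have h1 : (p n).leadingCoeff = R n n * (q n).leadingCoeff := by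
    rw [leadingCoeff, leadingCoeff, hnat hp, hnat hq]
    conv_lhs => rw [hR.expansion n]
    rw [finsetSum_coeff, Finset.sum_range_succ, Finset.sum_eq_zero, zero_add, coeff_smul,
      smul_eq_mul]
    intro k hk
    rw [coeff_smul, coeff_eq_zero_of_natDegree_lt, smul_zero]
    rw [hnat hq]
    exact Finset.mem_range.1 hk
  have h2 := hsign n
  rw [h1, mul_assoc] at h2
  exact pos_of_mul_pos_left h2 (mul_self_nonneg _)

/-- `r(X_P) = Rᵀ R` when `P = Q R` and `Q` is orthonormal for `r dμ`. -/
theorem functionOfJacobi_eq_sum {μ : Measure ℝ} {r : ℝ → ℝ} (hr : HasFiniteMoments μ r)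
    (hr0 : ∀ᵐ x ∂μ, 0 ≤ r x) {p q : ℕ → ℝ[X]}
    (hq : IsOrthonormalPolys (modifiedMeasure μ r) q) {R : Matrix ℕ ℕ ℝ}
    (hR : IsConnectionMatrix p q R) (i j : ℕ) {N : ℕ} (hi : i < N) (hj : j < N) :
    functionOfJacobi μ p r i j = ∑ k ∈ Finset.range N, R k i * R k j := by
  have hq' : ∀ k l, momentFunctional hr (q k * q l) = if k = l then 1 else 0 := by
    intro k l
    rw [momentFunctional_apply, ← hq.orthonormal k l,
      integral_modifiedMeasure hr.aestronglyMeasurable.aemeasurable hr0]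
    simp only [eval_mul]
  have hexp : ∀ i < N, p i = ∑ k ∈ Finset.range N, R k i • q k := by
    intro i hi
    refine (hR.expansion i).trans (Finset.sum_subset (Finset.range_subset_range.2 hi)
      fun k _ hk => ?_)
    rw [hR.upper k i (by simpa using hk), zero_smul]
  have h1 : functionOfJacobi μ p r i j = momentFunctional hr (p i * p j) := by
    rw [functionOfJacobi, Matrix.of_apply, momentFunctional_apply]
    refine integral_congr_ae (Filter.Eventually.of_forall fun x => ?_)
    simp only [eval_mul]
    ring
  rw [h1, hexp i hi, hexp j hj, Finset.sum_mul_sum, map_sum]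
  refine Finset.sum_congr rfl fun k hk => ?_
  rw [map_sum]
  simp only [smul_mul_smul_comm, map_smul, hq', smul_eq_mul, mul_ite, mul_one, mul_zero]
  rw [Finset.sum_ite_eq, if_pos hk]

end OrthoConn

theorem mainTheorem11
    (μ : Measure ℝ) (hμ : OrthoConn.HasFiniteMoments μ (fun _ => 1))
    (p : ℕ → ℝ[X]) (hp : OrthoConn.IsOrthonormalPolys μ p)
    (f : ℝ → ℝ) (hf_pos : ∀ x, 0 < x → 0 < f x)
    (hf_diff : DifferentiableOn ℝ f (Set.Ioi 0))
    (hf : OrthoConn.IsCompletelyMonotonic (deriv f))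
    (s : ℝ → ℝ) (hs_pos : ∀ᵐ x ∂μ, 0 < s x)
    (hs : OrthoConn.HasFiniteMoments μ s)
    (hdense : OrthoConn.PolynomialsDense (OrthoConn.modifiedMeasure μ (fun x => 1 + s x)))
    (r : ℝ → ℝ) (hr : r = f ∘ s)
    (q : ℕ → ℝ[X]) (hq : OrthoConn.IsOrthonormalPolys (OrthoConn.modifiedMeasure μ r) q)
    (hsign : ∀ n, 0 < (p n).leadingCoeff * (q n).leadingCoeff)
    (R : Matrix ℕ ℕ ℝ) (hR : OrthoConn.IsConnectionMatrix p q R)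
    (hS : ∀ n, OrthoConn.IsStieltjes
      (OrthoConn.finiteSection (OrthoConn.functionOfJacobi μ p s) n)) :
    ∀ n, OrthoConn.IsStieltjes
        (OrthoConn.finiteSection (OrthoConn.functionOfJacobi μ p r) n) ↔
      OrthoConn.IsMMatrix (OrthoConn.finiteSection R n) := by
  have hw : OrthoConn.IsStieltjesWeight μ p s := ⟨hμ, hp, hs_pos, hs, hdense, hS⟩
  have hB := OrthoConn.isBernstein_of_deriv hf_pos hf_diff hf
  have hrmom : OrthoConn.HasFiniteMoments μ r := hr ▸ hw.hasFiniteMoments_comp hB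
  have hr0 : ∀ᵐ x ∂μ, 0 ≤ r x := by
    filter_upwards [hs_pos] with x hx
    rw [hr]
    exact (hf_pos _ hx).le
  have hdiag := hR.diag_pos hp.degree_eq hq.degree_eq hsign
  have hoffr : ∀ i j, i ≠ j → OrthoConn.functionOfJacobi μ p r i j ≤ 0 := fun i j hij =>
    hr ▸ hw.functionOfJacobi_comp_nonpos hB hij
  have hoffR : ∀ i j, i < j → R i j ≤ 0 := by
    refine OrthoConn.upper_nonpos_of_gram_nonpos hdiag fun i j hij => ?_
    refine le_of_eq_of_le ?_ (hoffr i j hij.ne)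
    rw [OrthoConn.functionOfJacobi_eq_sum hrmom hr0 hq hR i j (hij.trans j.lt_succ_self)
      j.lt_succ_self]
    refine Finset.sum_subset (Finset.range_subset_range.2 (by omega)) fun k _ hk => ?_
    rw [hR.upper k i (by simpa using hk), zero_mul]
  intro n
  have htri : (OrthoConn.finiteSection R n).IsUpperTriangular := fun i j hij => hR.upper i j hij
  -- under the standing assumptions both properties hold
  refine iff_of_true ((OrthoConn.isStieltjes_iff _).2 ⟨?_, fun i j hij => ?_⟩)
    (OrthoConn.isMMatrix_of_isUpperTriangular htri (fun i => hdiag i) fun i j hij => ?_)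
  · have hgram : OrthoConn.finiteSection (OrthoConn.functionOfJacobi μ p r) n =
        (OrthoConn.finiteSection R n).conjTranspose * OrthoConn.finiteSection R n := by
      ext i j
      rw [OrthoConn.finiteSection, Matrix.submatrix_apply,
        OrthoConn.functionOfJacobi_eq_sum hrmom hr0 hq hR i j i.2 j.2, Matrix.mul_apply,
        ← Fin.sum_univ_eq_sum_range (fun k => R k i * R k j)]
      rfl
    rw [hgram]
    refine Matrix.PosDef.conjTranspose_mul_self _ (Matrix.mulVec_injective_of_isUnit ?_)
    rw [Matrix.isUnit_iff_isUnit_det, Matrix.det_of_isUpperTriangular htri, isUnit_iff_ne_zero]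
    exact Finset.prod_ne_zero_iff.2 fun i _ => (hdiag i).ne'
  · exact hoffr i j (Fin.val_injective.ne hij)
  · rcases lt_or_gt_of_ne hij with h | h
    · exact hoffR i j h
    · exact (htri h).le
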